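/- **Setting.** Let $N$ agents with positions $p^i\in\mathbb R^n$, velocities $v^i\in\mathbb R^n$ and inputs $u^i\in\mathbb R^m$ obey the undisturbed control-affine dynamics $$\dot p^i=v^i,\qquad \dot v^i=f^i(p^i,v^i,t)+B^i(p^i,v^i,t)\,u^i ,$$ in the presence of finitely many static obstacles. Let $\Xi\succ0$, $r_s,\Delta r_s>0$, $r_{\mathrm{sen}}>r_s+\Delta r_s$, $\|z\|_\Xi=\sqrt{z^\top\Xi z}$, with $\|z\|_\Xi\le r_{\mathrm{sen}}$ whenever $\|z\|\le r_{\mathrm{sen}}$, and with $\|z\|<r_{\mathrm{sen}}$ whenever $\|z\|_\Xi\le r_s+\Delta r_s$ (a colliding object is within sensing range). Put $h(z)=\frac{\|z\|_\Xi-(r_s+\Delta r_s)}{r_{\mathrm{sen}}-(r_s+\Delta r_s)}$. For agent $i$ let $\mathcal S^i$ be the set of other agents and obstacles $j$ with $\|p^{ij}\|\le r_{\mathrm{sen}}$, where $p^{ij}=p^j-p^i$, and $$H^i=\prod_{j\in\mathcal S^i}h(p^{ij}),\qquad \psi^i=-\log H^i,\qquad v_s^i=\alpha(H^i)\,\|\nabla_{p^i}\psi^i\|^{-2}\,\nabla_{p^i}\psi^i$$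 ($v^i_s=0$ if $\nabla_{p^i}\psi^i=0$; in derivatives of these functions $\mathcal S^i$ is held fixed), where $\alpha:[0,a]\to[0,\infty)$ is of class $\mathcal K$ (continuous, strictly increasing, $\alpha(0)=0$) with $a\ge1$ and $$\alpha(s)\le\frac{N-1}{-\log s+(N-1)}\quad\text{for all } s\in(0,1].$$ Let $k_p,k_v>0$, let $M^i(p^i,t)\succ0$ be differentiable, $B^i$ continuous, and $R^i\succ0$ a continuous function of the state of all agents and $t$. Write $e_v^i=v^i-v_s^i$, $\mathcal E^i=\tfrac12\|e_v^i\|_{M^i}^2$, $\phi_v^i=(B^i)^\top M^ie_v^i$, $f_s^i=f^i(p^i,v_s^i,t)$; $\dot v_s^i$ and $\dot M^i$ are the derivatives of $v^i_s$ and $M^i$ along the motion. Given a learned input $u_\ell^i$ (any function of the state of all agents and $t$), define $$\bar u_s^i=\begin{cases}\dfrac{\phi_v^i\left((e_v^i)^\top M^i(\dot v_s^i-f_s^i)-k_p(e_v^i)^\top\nabla_{p^i}\psi^i\right)}{\|\phi_v^i\|^2}&\phi_v^i\ne0\\ 0&\phi_v^i=0\end{cases},\qquad u_s^i=u_\ell^i-\begin{cases}\dfrac{\phi_v^i\,(u_\ell^i-\bar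 u_s^i)^\top\phi_v^i}{\|\phi_v^i\|^2}&(u_\ell^i-\bar u_s^i)^\top\phi_v^i>0\\ 0&\text{otherwise.}\end{cases}$$ **Conditions on a trajectory.** (a) *Contraction:* there is a matrix $A_s^i$ with $A_s^ie_v^i=f^i(p^i,v^i,t)-f_s^i$ and $\dot M^i+M^iA_s^i+(A_s^i)^\top M^i-2M^iB^i(R^i)^{-1}(B^i)^\top M^i\preceq-2k_vM^i .$ (b) *Natural safety:* if $\phi_v^i=0$, then $\dot{\mathcal V}^i\le k_p\alpha(H^i)-2k_v\mathcal E^i$, where $\dot{\mathcal V}^i=k_p(\nabla_{p^i}\psi^i)^\top v^i+\dot{\mathcal E}^i$ along the dynamics. A *solution* on $[0,T]$ is a pair of continuous functions $p,v$ which, outside a finite set of times, satisfies the dynamics, has locally constant neighbour sets $\mathcal S^i$, and passes through points at which $v_s^i$ is differentiable in the positions. A configuration is *collision-free* if $h(p^{ij})>0$ for every agent $i$ and every other agent or obstacle $j$ (sensed or not). **Theorem.** 1. *Safety.* Consider a solution on $[0,T]$ which starts collision-free, satisfies (a) and (b) for all $i$ outside the finite exceptional set of times, and whose inputs satisfy there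 $(u^i-\bar u_s^i)^\top\phi_v^i\le0$ for all $i$. Then it is collision-free on all of $[0,T]$. In particular this holds for the closed loop $u^i=u_s^i$ (under (a), (b) and a collision-free start). 2. *Optimality.* At every state and time, for each $i$, the problem $$\min_{u\in\mathbb R^m}\|u-u_\ell^i\|^2\quad\text{subject to}\quad(u-\bar u_s^i)^\top\phi_v^i\le0$$ is feasible, and $u_s^i$ is its unique minimizer. -/

import Mathlib

open Matrix Set Filter Topology

noncomputable section

/-- `ℝᵏ` with the Euclidean norm. -/
abbrev Vec (k : ℕ) : Type := EuclideanSpace ℝ (Fin k)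

/-- Matrix-vector product between Euclidean spaces. -/
def mulE {k l : ℕ} (A : Matrix (Fin k) (Fin l) ℝ) (x : Vec l) : Vec k :=
  WithLp.toLp 2 (A *ᵥ x.ofLp)

/-- The quadratic form `‖x‖_A² = xᵀ A x`. -/
def quadForm {k : ℕ} (A : Matrix (Fin k) (Fin k) ℝ) (x : Vec k) : ℝ :=
  inner ℝ x (mulE A x)

/-- The weighted 2-norm `‖x‖_A = √(xᵀ A x)`. -/
def weightedNorm {k : ℕ} (A : Matrix (Fin k) (Fin k) ℝ) (x : Vec k) : ℝ :=
  Real.sqrt (quadForm A x)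

/-- `α : [0, a] → [0, ∞)` is of class `𝒦`. -/
structure IsClassK (α : ℝ → ℝ) (a : ℝ) : Prop where
  pos : 0 < a
  zero : α 0 = 0
  continuousOn : ContinuousOn α (Icc 0 a)
  strictMonoOn : StrictMonoOn α (Icc 0 a)

/-- The data of the problem: `N` agents in `ℝⁿ` with inputs in `ℝᵐ`, and `L` static obstacles.
Agent `i` obeys `ṗ = v`, `v̇ = f i p v t + B i p v t u`. -/
structure MultiAgent (N n m L : ℕ) where
  /-- drift of agent `i`, a function of its own position, its own velocity and time -/
  f : Fin N → Vec n → Vec n → ℝ → Vec n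
  /-- actuation matrix of agent `i` -/
  B : Fin N → Vec n → Vec n → ℝ → Matrix (Fin n) (Fin m) ℝ
  /-- positions of the static obstacles -/
  obs : Fin L → Vec n
  /-- weight of the collision ellipsoid -/
  Xi : Matrix (Fin n) (Fin n) ℝ
  /-- minimal safe distance -/
  rs : ℝ
  /-- additional margin -/
  dr : ℝ
  /-- sensing radius -/
  rsen : ℝ
  /-- the class `𝒦` function of the safe velocity and the right end of its domain -/
  α : ℝ → ℝ
  a : ℝ
  kp : ℝ
  kv : ℝ
  /-- contraction metric of agent `i`, a function of its own position and time -/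
  M : Fin N → Vec n → ℝ → Matrix (Fin n) (Fin n) ℝ
  /-- weight of the contraction condition; it may depend on all positions and velocities -/
  R : Fin N → (Fin N → Vec n) → (Fin N → Vec n) → ℝ → Matrix (Fin m) (Fin m) ℝ

namespace MultiAgent

variable {N n m L : ℕ} (S : MultiAgent N n m L)

/-- Standing assumptions on the parameters, and regularity of the data. -/
structure Standing : Prop where
  Xi_posDef : S.Xi.PosDef
  rs_pos : 0 < S.rs
  dr_pos : 0 < S.dr
  radii : S.rs + S.dr < S.rsen
  /-- `sup_{‖z‖ ≤ r_sen} ‖z‖_Ξ ≤ r_sen` -/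
  Xi_le : ∀ z : Vec n, ‖z‖ ≤ S.rsen → weightedNorm S.Xi z ≤ S.rsen
  /-- the collision ellipsoid lies inside the open sensing ball -/
  sensed : ∀ z : Vec n, weightedNorm S.Xi z ≤ S.rs + S.dr → ‖z‖ < S.rsen
  classK : IsClassK S.α S.a
  kp_pos : 0 < S.kp
  kv_pos : 0 < S.kv
  B_cont : ∀ i, Continuous fun z : Vec n × Vec n × ℝ => S.B i z.1 z.2.1 z.2.2
  M_posDef : ∀ i x t, (S.M i x t).PosDef
  M_diff : ∀ i k l, Differentiable ℝ fun z : Vec n × ℝ => S.M i z.1 z.2 k l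
  R_posDef : ∀ i p v t, (S.R i p v t).PosDef
  R_cont : ∀ i, Continuous fun z : (Fin N → Vec n) × (Fin N → Vec n) × ℝ =>
    S.R i z.1 z.2.1 z.2.2

/-- The condition `α(s) ≤ (N-1)/(-log s + (N-1))` for `s ∈ (0,1]`, where `(0,1]` lies in the
domain `[0,a]` of `α`. -/
def AlphaBound : Prop :=
  1 ≤ S.a ∧ ∀ s ∈ Ioc (0 : ℝ) 1, S.α s ≤ ((N : ℝ) - 1) / (-Real.log s + ((N : ℝ) - 1))

/-! ### Safety functions -/

/-- `h(z) = (‖z‖_Ξ - (r_s + Δr_s)) / (r_sen - (r_s + Δr_s))`. -/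
def h (z : Vec n) : ℝ :=
  (weightedNorm S.Xi z - (S.rs + S.dr)) / (S.rsen - (S.rs + S.dr))

/-- Position of an object, which is an agent (`inl`) or an obstacle (`inr`). -/
def objPos (p : Fin N → Vec n) : Fin N ⊕ Fin L → Vec n
  | Sum.inl j => p j
  | Sum.inr k => S.obs k

open Classical in
/-- `𝒮ⁱ`: the objects other than agent `i` within its sensing radius. -/
def nbrs (p : Fin N → Vec n) (i : Fin N) : Finset (Fin N ⊕ Fin L) :=
  Finset.univ.filter fun o => o ≠ Sum.inl i ∧ ‖S.objPos p o - p i‖ ≤ S.rsen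

/-- No agent collides with another agent or with an obstacle: every `h(p^{ij})` is positive. -/
def Safe (p : Fin N → Vec n) : Prop :=
  ∀ i : Fin N, ∀ o : Fin N ⊕ Fin L, o ≠ Sum.inl i → 0 < S.h (S.objPos p o - p i)

/-- `Hⁱ = ∏_{j ∈ 𝒮ⁱ} h(p^{ij})` for the neighbour set `K`, agent `i` being at `x`. -/
def localH (K : Finset (Fin N ⊕ Fin L)) (p : Fin N → Vec n) (x : Vec n) : ℝ :=
  ∏ o ∈ K, S.h (S.objPos p o - x)

/-- `ψⁱ = -log ∏_{j ∈ 𝒮ⁱ} h(p^{ij})`. -/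
def psi (K : Finset (Fin N ⊕ Fin L)) (p : Fin N → Vec n) (x : Vec n) : ℝ :=
  -Real.log (S.localH K p x)

/-- `∇_{pⁱ} ψⁱ`: the gradient in the position of agent `i`, with the neighbour set `K` and all
other objects held fixed. -/
def gradPsi (K : Finset (Fin N ⊕ Fin L)) (p : Fin N → Vec n) (i : Fin N) : Vec n :=
  gradient (fun x => S.psi K p x) (p i)

/-- `v_sⁱ = α(Hⁱ) ‖∇ψⁱ‖⁻² ∇ψⁱ`, which is `0` where `∇ψⁱ = 0` (e.g. without neighbours). -/
def safeVel (K : Finset (Fin N ⊕ Fin L)) (i : Fin N) (p : Fin N → Vec n) : Vec n :=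
  (S.α (S.localH K p (p i)) * (‖S.gradPsi K p i‖ ^ 2)⁻¹) • S.gradPsi K p i

/-! ### Quantities at a joint state `(p, v)` and a time `t` -/

/-- The safe velocity at the current state. -/
def vs (i : Fin N) (p : Fin N → Vec n) : Vec n := S.safeVel (S.nbrs p i) i p

/-- `v̇_sⁱ`: the derivative of the safe velocity when all agents move with the velocities `v`. -/
def vsDot (i : Fin N) (p v : Fin N → Vec n) : Vec n :=
  fderiv ℝ (S.safeVel (S.nbrs p i) i) p v

/-- `∇_{pⁱ} ψⁱ` at the current state. -/
def gPsi (i : Fin N) (p : Fin N → Vec n) : Vec n := S.gradPsi (S.nbrs p i) p i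

/-- `Hⁱ` at the current state. -/
def Hi (i : Fin N) (p : Fin N → Vec n) : ℝ := S.localH (S.nbrs p i) p (p i)

/-- `e_vⁱ = vⁱ - v_sⁱ`. -/
def err (i : Fin N) (p v : Fin N → Vec n) : Vec n := v i - S.vs i p

/-- `ℰⁱ = ‖vⁱ - v_sⁱ‖²_M / 2`. -/
def lyap (i : Fin N) (p v : Fin N → Vec n) (t : ℝ) : ℝ :=
  quadForm (S.M i (p i) t) (S.err i p v) / 2

/-- `φ_vⁱ = Bᵀ M e_vⁱ`. -/
def phi (i : Fin N) (p v : Fin N → Vec n) (t : ℝ) : Vec m :=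
  mulE (S.B i (p i) (v i) t)ᵀ (mulE (S.M i (p i) t) (S.err i p v))

/-- `Ṁⁱ = ∂_t M + ∂_p M · vⁱ`, entrywise. -/
def MDot (i : Fin N) (p v : Fin N → Vec n) (t : ℝ) : Matrix (Fin n) (Fin n) ℝ :=
  Matrix.of fun k l => fderiv ℝ (fun z : Vec n × ℝ => S.M i z.1 z.2 k l) (p i, t) (v i, 1)

/-- `f_sⁱ = f(pⁱ, v_sⁱ, t)`. -/
def fs (i : Fin N) (p : Fin N → Vec n) (t : ℝ) : Vec n := S.f i (p i) (S.vs i p) t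

/-- `A` is a state-dependent coefficient matrix at the state:
`A (vⁱ - v_sⁱ) = f(pⁱ, vⁱ, t) - f(pⁱ, v_sⁱ, t)`. -/
def IsSDC (i : Fin N) (p v : Fin N → Vec n) (t : ℝ) (A : Matrix (Fin n) (Fin n) ℝ) : Prop :=
  mulE A (S.err i p v) = S.f i (p i) (v i) t - S.fs i p t

/-- The contraction condition `Ṁ + M A + Aᵀ M - 2 M B R⁻¹ Bᵀ M ≤ -2 k_v M` at the state, for some
state-dependent coefficient matrix `A`. -/
def Contraction (i : Fin N) (p v : Fin N → Vec n) (t : ℝ) : Prop :=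
  ∃ A : Matrix (Fin n) (Fin n) ℝ, S.IsSDC i p v t A ∧
    Matrix.PosSemidef ((-(2 * S.kv)) • S.M i (p i) t -
      (S.MDot i p v t + S.M i (p i) t * A + Aᵀ * S.M i (p i) t
        - (2 : ℝ) • (S.M i (p i) t * S.B i (p i) (v i) t * (S.R i p v t)⁻¹ *
            (S.B i (p i) (v i) t)ᵀ * S.M i (p i) t)))

/-- The derivative of `ℰⁱ` along `v̇ⁱ = f + B u`. -/
def lyapDot (i : Fin N) (p v : Fin N → Vec n) (t : ℝ) (u : Vec m) : ℝ :=
  inner ℝ (S.err i p v) (mulE (S.M i (p i) t)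
      (S.f i (p i) (v i) t + mulE (S.B i (p i) (v i) t) u - S.vsDot i p v))
    + quadForm (S.MDot i p v t) (S.err i p v) / 2

/-- `𝒱̇ⁱ` for `𝒱ⁱ = k_p ψⁱ + ℰⁱ` along `ṗⁱ = vⁱ`, `v̇ⁱ = f + B u`.  The barrier part is agent `i`'s
contribution `∇_{pⁱ}ψⁱ · vⁱ` to the rate of the total barrier, which is `∑ᵢ ∇_{pⁱ}ψⁱ · vⁱ`. -/
def VDot (i : Fin N) (p v : Fin N → Vec n) (t : ℝ) (u : Vec m) : ℝ :=
  S.kp * inner ℝ (S.gPsi i p) (v i) + S.lyapDot i p v t u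

/-- If `φ_vⁱ = 0` then `𝒱̇ⁱ ≤ k_p α(Hⁱ) - 2 k_v ℰⁱ` (in this case `𝒱̇ⁱ` does not depend on `u`). -/
def Natural (i : Fin N) (p v : Fin N → Vec n) (t : ℝ) : Prop :=
  S.phi i p v t = 0 → ∀ u : Vec m,
    S.VDot i p v t u ≤ S.kp * S.α (S.Hi i p) - 2 * S.kv * S.lyap i p v t

/-! ### The safety filter -/

open Classical in
/-- `ū_sⁱ`. -/
def uBar (i : Fin N) (p v : Fin N → Vec n) (t : ℝ) : Vec m :=
  if ‖S.phi i p v t‖ ≠ 0 then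
    ((inner ℝ (S.err i p v) (mulE (S.M i (p i) t) (S.vsDot i p v - S.fs i p t))
        - S.kp * inner ℝ (S.err i p v) (S.gPsi i p)) / ‖S.phi i p v t‖ ^ 2) • S.phi i p v t
  else 0

open Classical in
/-- The filtered input `u_sⁱ` for the value `w` of the learned input. -/
def uSafe (i : Fin N) (p v : Fin N → Vec n) (t : ℝ) (w : Vec m) : Vec m :=
  w - if 0 < inner ℝ (w - S.uBar i p v t) (S.phi i p v t) then
      (inner ℝ (w - S.uBar i p v t) (S.phi i p v t) / ‖S.phi i p v t‖ ^ 2) • S.phi i p v t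
    else 0

/-- The feasible set `{u | (u - ū_s)ᵀ φ_v ≤ 0}` of the quadratic program. -/
def feasible (i : Fin N) (p v : Fin N → Vec n) (t : ℝ) : Set (Vec m) :=
  {u | inner ℝ (u - S.uBar i p v t) (S.phi i p v t) ≤ 0}

/-! ### Trajectories -/

/-- `(p, v)` is a solution on `[0, T]` of the undisturbed system with the inputs `u`: it is
continuous, and outside a finite set `Z` of times (at which neighbour sets may change or a safe
velocity may fail to be differentiable) it satisfies `ṗⁱ = vⁱ`, `v̇ⁱ = fⁱ + Bⁱ uⁱ`, the neighbour
sets are locally constant in time, and the safe velocities are differentiable at `p t`. -/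
structure IsSolution (T : ℝ) (Z : Finset ℝ) (p v : ℝ → Fin N → Vec n)
    (u : ℝ → Fin N → Vec m) : Prop where
  p_cont : ContinuousOn p (Icc 0 T)
  v_cont : ContinuousOn v (Icc 0 T)
  p_deriv : ∀ t ∈ Ioo 0 T, t ∉ Z → ∀ i, HasDerivAt (fun s => p s i) (v t i) t
  v_deriv : ∀ t ∈ Ioo 0 T, t ∉ Z → ∀ i, HasDerivAt (fun s => v s i)
    (S.f i (p t i) (v t i) t + mulE (S.B i (p t i) (v t i) t) (u t i)) t
  nbrs_const : ∀ t ∈ Ioo 0 T, t ∉ Z → ∀ i, ∀ᶠ s in 𝓝 t, S.nbrs (p s) i = S.nbrs (p t) i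
  vs_diff : ∀ t ∈ Ioo 0 T, t ∉ Z → ∀ i,
    DifferentiableAt ℝ (S.safeVel (S.nbrs (p t) i) i) (p t)

end MultiAgent

end

open Matrix Set Filter Topology

/-! Safety is a Grönwall argument for `totalLyap`, which is `kp` times the barriers `-log h` of all
sensed pairs plus the tracking energies `lyap`. A pair of agents occurs in two neighbour sets and so
gets weight 1/2. Sensing is symmetric and the barrier is even, hence the barriers change at the rate
`∑ i, ⟪gPsi i, v i⟫` (`Standing.sum_inner_gPsi`), and the derivative of `totalLyap` is the sum of
the `VDot i`.

For a feasible input, `uBar` is chosen to cancel `vsDot`, `fs` and the part of the barrier rate due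
to the tracking error. What remains is the barrier rate along `vs`, at most `α (Hi) ≤ α 1`, and the
contraction term. The contraction condition leaves the surplus `gain`, a quadratic form in the error
(`Standing.VDot_le`). On a compact time interval this form is at most `C * lyap`
(`IsSolution.exists_gain_le`), so `totalLyap' ≤ const + C * totalLyap`, and `totalLyap` stays
bounded on any bounded interval free of exceptional times and collisions.

At a first collision time `τ` only an interval just before `τ` is needed, so jumps of `totalLyap` at
earlier changes of neighbours do no harm. A colliding object is strictly inside the sensing range,
so it is already a neighbour shortly before `τ`; the bounded barrier keeps its `h` away from zero
there, and continuity gives a contradiction (`Standing.safe_of_totalBarrier_le`).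

Optimality holds because `uSafe` is the Euclidean projection of the learned input onto the
half-space `feasible`. -/

/-! ### Matrices and quadratic forms on Euclidean space. -/

lemma inner_eq_sum_mul {k : ℕ} (x y : Vec k) : inner ℝ x y = ∑ a, x a * y a := by
  simp [PiLp.inner_apply, mul_comm]

lemma mulE_apply {k l : ℕ} (A : Matrix (Fin k) (Fin l) ℝ) (x : Vec l) (a : Fin k) :
    mulE A x a = ∑ b, A a b * x b := rfl

lemma mulE_add {k l : ℕ} (A : Matrix (Fin k) (Fin l) ℝ) (x y : Vec l) :
    mulE A (x + y) = mulE A x + mulE A y := by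
  simp [mulE, Matrix.mulVec_add]

lemma mulE_sub {k l : ℕ} (A : Matrix (Fin k) (Fin l) ℝ) (x y : Vec l) :
    mulE A (x - y) = mulE A x - mulE A y := by
  simp [mulE, Matrix.mulVec_sub]

lemma mulE_smul {k l : ℕ} (A : Matrix (Fin k) (Fin l) ℝ) (c : ℝ) (x : Vec l) :
    mulE A (c • x) = c • mulE A x := by
  simp [mulE, Matrix.mulVec_smul]

lemma add_mulE {k l : ℕ} (A B : Matrix (Fin k) (Fin l) ℝ) (x : Vec l) :
    mulE (A + B) x = mulE A x + mulE B x := by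
  simp [mulE, Matrix.add_mulVec]

lemma sub_mulE {k l : ℕ} (A B : Matrix (Fin k) (Fin l) ℝ) (x : Vec l) :
    mulE (A - B) x = mulE A x - mulE B x := by
  simp [mulE, Matrix.sub_mulVec]

lemma smul_mulE {k l : ℕ} (c : ℝ) (A : Matrix (Fin k) (Fin l) ℝ) (x : Vec l) :
    mulE (c • A) x = c • mulE A x := by
  simp [mulE, Matrix.smul_mulVec]

lemma mul_mulE {k l r : ℕ} (A : Matrix (Fin k) (Fin l) ℝ) (B : Matrix (Fin l) (Fin r) ℝ)
    (x : Vec r) : mulE (A * B) x = mulE A (mulE B x) := by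
  simp [mulE, Matrix.mulVec_mulVec]

lemma inner_mulE {k l : ℕ} (A : Matrix (Fin k) (Fin l) ℝ) (x : Vec k) (y : Vec l) :
    inner ℝ x (mulE A y) = inner ℝ (mulE Aᵀ x) y := by
  simp only [inner_eq_sum_mul, mulE_apply, Matrix.transpose_apply, Finset.mul_sum,
    Finset.sum_mul]
  rw [Finset.sum_comm]
  exact Finset.sum_congr rfl fun b _ => Finset.sum_congr rfl fun a _ => by ring

lemma quadForm_eq_sum {k : ℕ} (A : Matrix (Fin k) (Fin k) ℝ) (x : Vec k) :
    quadForm A x = ∑ a, ∑ b, x a * (A a b * x b) := by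
  simp only [quadForm, inner_eq_sum_mul, mulE_apply, Finset.mul_sum]

lemma quadForm_eq_dotProduct {k : ℕ} (A : Matrix (Fin k) (Fin k) ℝ) (x : Vec k) :
    quadForm A x = x.ofLp ⬝ᵥ (A *ᵥ x.ofLp) := by
  simp only [quadForm, inner_eq_sum_mul]; rfl

lemma quadForm_smul_right {k : ℕ} (A : Matrix (Fin k) (Fin k) ℝ) (c : ℝ) (x : Vec k) :
    quadForm A (c • x) = c ^ 2 * quadForm A x := by
  simp only [quadForm, mulE_smul, inner_smul_left, inner_smul_right, conj_trivial]
  ring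

lemma quadForm_neg {k : ℕ} (A : Matrix (Fin k) (Fin k) ℝ) (x : Vec k) :
    quadForm A (-x) = quadForm A x := by
  simpa using quadForm_smul_right A (-1) x

lemma quadForm_nonneg {k : ℕ} {A : Matrix (Fin k) (Fin k) ℝ} (hA : A.PosSemidef) (x : Vec k) :
    0 ≤ quadForm A x := by
  rw [quadForm_eq_dotProduct]
  simpa using hA.dotProduct_mulVec_nonneg x.ofLp

lemma quadForm_pos {k : ℕ} {A : Matrix (Fin k) (Fin k) ℝ} (hA : A.PosDef) {x : Vec k}
    (hx : x ≠ 0) : 0 < quadForm A x := by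
  rw [quadForm_eq_dotProduct]
  simpa using hA.dotProduct_mulVec_pos (x := x.ofLp) (by simpa using hx)

lemma Matrix.PosDef.transpose_eq {k : ℕ} {A : Matrix (Fin k) (Fin k) ℝ} (hA : A.PosDef) :
    Aᵀ = A := by
  simpa using hA.isHermitian.eq

lemma continuousOn_quadForm_prod {X : Type*} [TopologicalSpace X] {k : ℕ} {K : Set X}
    {F : X → Matrix (Fin k) (Fin k) ℝ} (hF : ContinuousOn F K) (E : Set (Vec k)) :
    ContinuousOn (fun z : X × Vec k => quadForm (F z.1) z.2) (K ×ˢ E) := by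
  have h1 : ContinuousOn (fun z : X × Vec k => F z.1) (K ×ˢ E) :=
    hF.comp continuousOn_fst fun z hz => hz.1
  have h2 : ∀ a b, ContinuousOn (fun z : X × Vec k => F z.1 a b) (K ×ˢ E) := fun a b =>
    continuousOn_pi.1 (continuousOn_pi.1 h1 a) b
  have h3 : ∀ a, ContinuousOn (fun z : X × Vec k => z.2 a) (K ×ˢ E) := fun a =>
    Continuous.continuousOn (by fun_prop)
  simp only [quadForm_eq_sum]
  exact continuousOn_finsetSum _ fun a _ => continuousOn_finsetSum _ fun b _ =>
    (h3 a).mul ((h2 a b).mul (h3 b))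

lemma exists_quadForm_div_le {X : Type*} [TopologicalSpace X] {k : ℕ} {K : Set X}
    (hK : IsCompact K) {G M : X → Matrix (Fin k) (Fin k) ℝ} (hG : ContinuousOn G K)
    (hM : ContinuousOn M K) (hpos : ∀ t ∈ K, (M t).PosDef) :
    ∃ C : ℝ, ∀ t ∈ K, ∀ x ∈ Metric.sphere (0 : Vec k) 1,
      quadForm (G t) x / quadForm (M t) x ≤ C := by
  have hS : IsCompact (K ×ˢ Metric.sphere (0 : Vec k) 1) := hK.prod (isCompact_sphere 0 1)
  have hMpos : ∀ z ∈ K ×ˢ Metric.sphere (0 : Vec k) 1, quadForm (M z.1) z.2 ≠ 0 := by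
    rintro ⟨t, x⟩ ⟨h1, h2⟩
    refine (quadForm_pos (hpos _ h1) ?_).ne'
    rintro rfl
    simp at h2
  have hdiv : ContinuousOn (fun z : X × Vec k => quadForm (G z.1) z.2 / quadForm (M z.1) z.2)
      (K ×ˢ Metric.sphere (0 : Vec k) 1) :=
    (continuousOn_quadForm_prod hG _).div (continuousOn_quadForm_prod hM _) hMpos
  obtain ⟨C, hC⟩ := hS.bddAbove_image hdiv
  exact ⟨C, fun t ht x hx => hC ⟨(t, x), ⟨ht, hx⟩, rfl⟩⟩

/-- On a compact set of parameters a continuous family of quadratic forms is dominated by a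
continuous family of positive definite ones. -/
lemma exists_quadForm_le_mul {X : Type*} [TopologicalSpace X] {k : ℕ} {K : Set X}
    (hK : IsCompact K) {G M : X → Matrix (Fin k) (Fin k) ℝ} (hG : ContinuousOn G K)
    (hM : ContinuousOn M K) (hpos : ∀ t ∈ K, (M t).PosDef) :
    ∃ C : ℝ, ∀ t ∈ K, ∀ x : Vec k, quadForm (G t) x ≤ C * quadForm (M t) x := by
  obtain ⟨C, hC⟩ := exists_quadForm_div_le hK hG hM hpos
  refine ⟨C, fun t ht x => ?_⟩
  rcases eq_or_ne x 0 with rfl | hx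
  · simp [quadForm]
  have hn : ‖x‖ ≠ 0 := norm_ne_zero_iff.2 hx
  have h1 := hC t ht (‖x‖⁻¹ • x) (by simp [norm_smul, hn])
  have hp : 0 < quadForm (M t) (‖x‖⁻¹ • x) := quadForm_pos (hpos t ht) (by simp [hx])
  have h2 := (div_le_iff₀ hp).1 h1
  rw [quadForm_smul_right, quadForm_smul_right] at h2
  have h3 : 0 < ‖x‖⁻¹ ^ 2 := by positivity
  rw [mul_left_comm] at h2
  exact le_of_mul_le_mul_left h2 h3

lemma hasDerivAt_quadForm {k : ℕ} {A : ℝ → Matrix (Fin k) (Fin k) ℝ}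
    {A' : Matrix (Fin k) (Fin k) ℝ} {x : ℝ → Vec k} {x' : Vec k} {t : ℝ}
    (hA : ∀ a b, HasDerivAt (fun s => A s a b) (A' a b) t) (hx : HasDerivAt x x' t)
    (hs : (A t)ᵀ = A t) :
    HasDerivAt (fun s => quadForm (A s) (x s))
      (2 * inner ℝ (x t) (mulE (A t) x') + quadForm A' (x t)) t := by
  have hxc : ∀ a, HasDerivAt (fun s => x s a) (x' a) t := fun a =>
    ((EuclideanSpace.proj (𝕜 := ℝ) a).hasFDerivAt.comp_hasDerivAt t hx)
  have h := HasDerivAt.fun_sum (u := Finset.univ) fun a _ =>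
    HasDerivAt.fun_sum (u := Finset.univ) fun b _ => (hxc a).mul ((hA a b).mul (hxc b))
  simp only [quadForm_eq_sum A', funext fun s => quadForm_eq_sum (A s) (x s)]
  refine h.congr_deriv ?_
  -- Symmetry of `A t` identifies the two product-rule terms in which `x` is differentiated.
  have e1 : inner ℝ (x t) (mulE (A t) x') = inner ℝ x' (mulE (A t) (x t)) := by
    rw [inner_mulE, hs, real_inner_comm]
  rw [two_mul]
  nth_rewrite 1 [e1]
  simp only [inner_eq_sum_mul, mulE_apply, Finset.mul_sum, ← Finset.sum_add_distrib]
  exact Finset.sum_congr rfl fun a _ => Finset.sum_congr rfl fun b _ => by simp; ring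

lemma differentiable_quadForm {k : ℕ} (A : Matrix (Fin k) (Fin k) ℝ) :
    Differentiable ℝ (quadForm A) := by
  have : quadForm A = fun x : Vec k => ∑ a, ∑ b, x a * (A a b * x b) :=
    funext fun x => quadForm_eq_sum A x
  rw [this]
  fun_prop

namespace MultiAgent

variable {N n m L : ℕ} {S : MultiAgent N n m L}

/-! ### The function `h`, the pair barrier and the gradient of `psi`. -/

lemma h_neg (z : Vec n) : S.h (-z) = S.h z := by
  simp [h, weightedNorm, quadForm_neg]

lemma h_sub_comm (x y : Vec n) : S.h (x - y) = S.h (y - x) := by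
  rw [← neg_sub, h_neg]

lemma continuous_h : Continuous S.h := by
  have := (differentiable_quadForm S.Xi).continuous
  unfold h weightedNorm
  fun_prop

lemma Standing.h_pos_iff (hS : S.Standing) (z : Vec n) :
    0 < S.h z ↔ S.rs + S.dr < weightedNorm S.Xi z := by
  rw [h, div_pos_iff_of_pos_right (sub_pos.2 hS.radii), sub_pos]

/-- Where `h` is positive the weighted norm exceeds `rs + dr > 0`, so the square root is taken away
from its singularity. -/
lemma Standing.differentiableAt_h (hS : S.Standing) {z : Vec n} (hz : 0 < S.h z) :
    DifferentiableAt ℝ S.h z := by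
  have h1 : 0 < weightedNorm S.Xi z :=
    (add_pos hS.rs_pos hS.dr_pos).trans ((hS.h_pos_iff z).1 hz)
  have h2 : quadForm S.Xi z ≠ 0 := (Real.sqrt_pos.1 h1).ne'
  have h3 : DifferentiableAt ℝ (weightedNorm S.Xi) z :=
    (differentiable_quadForm S.Xi z).sqrt h2
  have h4 : S.h = fun z => (weightedNorm S.Xi z - (S.rs + S.dr)) *
      (S.rsen - (S.rs + S.dr))⁻¹ := rfl
  rw [h4]
  exact (h3.sub_const _).mul_const _

lemma Standing.h_le_one (hS : S.Standing) {z : Vec n} (hz : ‖z‖ ≤ S.rsen) : S.h z ≤ 1 := by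
  rw [h, div_le_one (sub_pos.2 hS.radii)]
  linarith [hS.Xi_le z hz]

variable (S) in
/-- The barrier `-log h` of a single relative position. -/
noncomputable def barrier (z : Vec n) : ℝ := -Real.log (S.h z)

lemma Standing.differentiableAt_barrier (hS : S.Standing) {z : Vec n} (hz : 0 < S.h z) :
    DifferentiableAt ℝ S.barrier z :=
  ((hS.differentiableAt_h hz).log hz.ne').neg

lemma Standing.barrier_nonneg (hS : S.Standing) {z : Vec n} (hz : 0 < S.h z)
    (hr : ‖z‖ ≤ S.rsen) : 0 ≤ S.barrier z :=
  neg_nonneg.2 (Real.log_nonpos hz.le (hS.h_le_one hr))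

/-- An even function has an odd derivative. The chain rule for scaling by `-1` needs no
differentiability at `z`. -/
lemma fderiv_barrier_neg (z w : Vec n) :
    fderiv ℝ S.barrier (-z) w = -fderiv ℝ S.barrier z w := by
  have h1 : (fun y => S.barrier ((-1 : ℝ) • y)) = S.barrier := by
    funext y
    simp [barrier, h_neg]
  have h2 := fderiv_comp_smul (f := S.barrier) (x := z) (-1 : ℝ)
  rw [h1] at h2
  rw [h2]
  simp

lemma fderiv_barrier_sub_comm (x y w : Vec n) :
    fderiv ℝ S.barrier (x - y) w = -fderiv ℝ S.barrier (y - x) w := by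
  rw [← neg_sub, fderiv_barrier_neg]

lemma localH_pos {K : Finset (Fin N ⊕ Fin L)} {p : Fin N → Vec n} {x : Vec n}
    (hK : ∀ o ∈ K, 0 < S.h (S.objPos p o - x)) : 0 < S.localH K p x :=
  Finset.prod_pos hK

lemma psi_eq_sum {K : Finset (Fin N ⊕ Fin L)} {p : Fin N → Vec n} {x : Vec n}
    (hK : ∀ o ∈ K, 0 < S.h (S.objPos p o - x)) :
    S.psi K p x = ∑ o ∈ K, S.barrier (S.objPos p o - x) := by
  simp only [psi, localH, barrier, Finset.sum_neg_distrib]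
  rw [Real.log_prod fun o ho => (hK o ho).ne']

/-- Near `p i` all factors stay positive, so the logarithm splits the product into pair barriers.
The sign comes from the agent's position entering the relative position negatively. -/
lemma Standing.inner_gradPsi (hS : S.Standing) {K : Finset (Fin N ⊕ Fin L)}
    {p : Fin N → Vec n} {i : Fin N} (hK : ∀ o ∈ K, 0 < S.h (S.objPos p o - p i)) (w : Vec n) :
    inner ℝ (S.gradPsi K p i) w = -∑ o ∈ K, fderiv ℝ S.barrier (S.objPos p o - p i) w := by
  have hev : (fun x => S.psi K p x) =ᶠ[𝓝 (p i)]
      fun x => ∑ o ∈ K, S.barrier (S.objPos p o - x) := by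
    have : ∀ᶠ x in 𝓝 (p i), ∀ o ∈ K, 0 < S.h (S.objPos p o - x) := by
      rw [Filter.eventually_all_finset]
      intro o ho
      have hc : Continuous fun x => S.h (S.objPos p o - x) :=
        continuous_h.comp (continuous_const.sub continuous_id)
      exact hc.continuousAt.eventually (lt_mem_nhds (hK o ho))
    filter_upwards [this] with x hx using psi_eq_sum hx
  have hd : HasFDerivAt (fun x => ∑ o ∈ K, S.barrier (S.objPos p o - x))
      (∑ o ∈ K, (fderiv ℝ S.barrier (S.objPos p o - p i)).comp
        (-ContinuousLinearMap.id ℝ (Vec n))) (p i) :=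
    HasFDerivAt.fun_sum fun o ho =>
      (hS.differentiableAt_barrier (hK o ho)).hasFDerivAt.comp (p i)
        ((hasFDerivAt_id (p i)).const_sub _)
  rw [gradPsi, inner_gradient_left, hev.fderiv_eq, hd.fderiv]
  simp

lemma mem_nbrs {p : Fin N → Vec n} {i : Fin N} {o : Fin N ⊕ Fin L} :
    o ∈ S.nbrs p i ↔ o ≠ Sum.inl i ∧ ‖S.objPos p o - p i‖ ≤ S.rsen := by
  simp [nbrs]

lemma Safe.h_pos_of_mem_nbrs {p : Fin N → Vec n} (hp : S.Safe p) (i : Fin N) :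
    ∀ o ∈ S.nbrs p i, 0 < S.h (S.objPos p o - p i) := fun o ho =>
  hp i o (mem_nbrs.1 ho).1

lemma Safe.Hi_pos {p : Fin N → Vec n} (hp : S.Safe p) (i : Fin N) : 0 < S.Hi i p :=
  localH_pos (hp.h_pos_of_mem_nbrs i)

lemma Standing.Hi_le_one (hS : S.Standing) {p : Fin N → Vec n} (hp : S.Safe p) (i : Fin N) :
    S.Hi i p ≤ 1 :=
  Finset.prod_le_one (fun o ho => (hp.h_pos_of_mem_nbrs i o ho).le)
    fun _ ho => hS.h_le_one (mem_nbrs.1 ho).2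

lemma Standing.alpha_nonneg (hS : S.Standing) {s : ℝ} (hs : s ∈ Icc 0 S.a) : 0 ≤ S.α s :=
  hS.classK.zero.symm.le.trans (hS.classK.strictMonoOn.monotoneOn
    (left_mem_Icc.2 hS.classK.pos.le) hs hs.1)

lemma Standing.alpha_Hi_nonneg (hS : S.Standing) (ha : 1 ≤ S.a) {p : Fin N → Vec n}
    (hp : S.Safe p) (i : Fin N) : 0 ≤ S.α (S.Hi i p) :=
  hS.alpha_nonneg ⟨(hp.Hi_pos i).le, (hS.Hi_le_one hp i).trans ha⟩

lemma Standing.alpha_Hi_le (hS : S.Standing) (ha : 1 ≤ S.a) {p : Fin N → Vec n}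
    (hp : S.Safe p) (i : Fin N) : S.α (S.Hi i p) ≤ S.α 1 :=
  hS.classK.strictMonoOn.monotoneOn ⟨(hp.Hi_pos i).le, (hS.Hi_le_one hp i).trans ha⟩
    ⟨zero_le_one, ha⟩ (hS.Hi_le_one hp i)

/-- The normalisation in `vs` makes this an equality when the gradient is nonzero; for a zero
gradient the left side is `0`, which is where `hα` enters. -/
lemma inner_gPsi_vs_le {p : Fin N → Vec n} {i : Fin N} (hα : 0 ≤ S.α (S.Hi i p)) :
    inner ℝ (S.gPsi i p) (S.vs i p) ≤ S.α (S.Hi i p) := by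
  change inner ℝ (S.gPsi i p) ((S.α (S.Hi i p) * (‖S.gPsi i p‖ ^ 2)⁻¹) • S.gPsi i p) ≤ _
  rw [inner_smul_right, real_inner_self_eq_norm_sq, mul_assoc]
  exact mul_le_of_le_one_right hα inv_mul_le_one

/-! ### The dissipation inequality at a single state. -/

variable (S) in
/-- The Riccati-type weight `M B R⁻¹ Bᵀ M`. -/
noncomputable def gain (i : Fin N) (p v : Fin N → Vec n) (t : ℝ) : Matrix (Fin n) (Fin n) ℝ :=
  S.M i (p i) t * S.B i (p i) (v i) t * (S.R i p v t)⁻¹ * (S.B i (p i) (v i) t)ᵀ *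
    S.M i (p i) t

lemma quadForm_gain_of_phi_eq_zero {i : Fin N} {p v : Fin N → Vec n} {t : ℝ}
    (hφ : S.phi i p v t = 0) : quadForm (S.gain i p v t) (S.err i p v) = 0 := by
  rw [phi] at hφ
  have h0 : ∀ {k l : ℕ} (A : Matrix (Fin k) (Fin l) ℝ), mulE A 0 = 0 := fun A => by simp [mulE]
  simp only [quadForm, gain, mul_mulE, hφ, h0, inner_zero_right]

/-- The input acts on the tracking energy only through its component along `phi`. -/
lemma Standing.inner_err_actuation (hS : S.Standing) (i : Fin N) (p v : Fin N → Vec n) (t : ℝ)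
    (u : Vec m) :
    inner ℝ (S.err i p v) (mulE (S.M i (p i) t) (mulE (S.B i (p i) (v i) t) u)) =
      inner ℝ u (S.phi i p v t) := by
  rw [inner_mulE, inner_mulE, (hS.M_posDef i (p i) t).transpose_eq, real_inner_comm, phi]

lemma inner_uBar_phi {i : Fin N} {p v : Fin N → Vec n} {t : ℝ} (hφ : S.phi i p v t ≠ 0) :
    inner ℝ (S.uBar i p v t) (S.phi i p v t) =
      inner ℝ (S.err i p v) (mulE (S.M i (p i) t) (S.vsDot i p v - S.fs i p t))
        - S.kp * inner ℝ (S.err i p v) (S.gPsi i p) := by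
  have hn : ‖S.phi i p v t‖ ≠ 0 := norm_ne_zero_iff.2 hφ
  rw [uBar, if_pos hn, inner_smul_left, real_inner_self_eq_norm_sq, conj_trivial,
    div_mul_cancel₀ _ (pow_ne_zero 2 hn)]

/-- The contraction condition, evaluated at the tracking error. -/
lemma Contraction.le (hS : S.Standing) {i : Fin N} {p v : Fin N → Vec n} {t : ℝ}
    (h : S.Contraction i p v t) :
    inner ℝ (S.err i p v) (mulE (S.M i (p i) t) (S.f i (p i) (v i) t - S.fs i p t)) +
        quadForm (S.MDot i p v t) (S.err i p v) / 2 ≤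
      quadForm (S.gain i p v t) (S.err i p v) - 2 * S.kv * S.lyap i p v t := by
  obtain ⟨A, hA, hP⟩ := h
  have h1 := quadForm_nonneg hP (S.err i p v)
  rw [IsSDC] at hA
  -- The terms `M A` and `Aᵀ M` have the same quadratic form, which accounts for the factor 1/2
  -- against the matrix inequality.
  have h2 : inner ℝ (S.err i p v) (mulE Aᵀ (mulE (S.M i (p i) t) (S.err i p v))) =
      inner ℝ (S.err i p v) (mulE (S.M i (p i) t) (mulE A (S.err i p v))) := by
    rw [inner_mulE, inner_mulE, transpose_transpose, (hS.M_posDef i (p i) t).transpose_eq,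
      real_inner_comm]
  change 0 ≤ quadForm (_ - (_ - (2 : ℝ) • S.gain i p v t)) _ at h1
  rw [← hA, lyap]
  simp only [quadForm, sub_mulE, add_mulE, smul_mulE, mul_mulE (S.M i (p i) t) A,
    mul_mulE Aᵀ (S.M i (p i) t), inner_sub_right, inner_add_right, inner_smul_right, h2] at h1 ⊢
  linarith

lemma Standing.lyap_nonneg (hS : S.Standing) (i : Fin N) (p v : Fin N → Vec n) (t : ℝ) :
    0 ≤ S.lyap i p v t :=
  div_nonneg (quadForm_nonneg (hS.M_posDef i (p i) t).posSemidef _) zero_le_two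

/-- The dissipation inequality for a feasible input. -/
lemma Standing.VDot_le (hS : S.Standing) (ha : 1 ≤ S.a) {i : Fin N} {p v : Fin N → Vec n}
    {t : ℝ} {u : Vec m} (hp : S.Safe p) (hC : S.Contraction i p v t)
    (hN : S.Natural i p v t) (hu : u ∈ S.feasible i p v t) :
    S.VDot i p v t u ≤ S.kp * S.α 1 + quadForm (S.gain i p v t) (S.err i p v) := by
  have hkE := mul_nonneg hS.kv_pos.le (hS.lyap_nonneg i p v t)
  have hα := mul_le_mul_of_nonneg_left (hS.alpha_Hi_le ha hp i) hS.kp_pos.le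
  by_cases hφ : S.phi i p v t = 0
  · have := hN hφ u
    rw [quadForm_gain_of_phi_eq_zero hφ]
    linarith
  have h1 : inner ℝ u (S.phi i p v t) ≤ inner ℝ (S.uBar i p v t) (S.phi i p v t) := by
    have : inner ℝ (u - S.uBar i p v t) (S.phi i p v t) ≤ 0 := hu
    rw [inner_sub_left] at this
    linarith
  rw [inner_uBar_phi hφ] at h1
  have h2 := hC.le hS
  have h3 := mul_le_mul_of_nonneg_left (inner_gPsi_vs_le (hS.alpha_Hi_nonneg ha hp i))
    hS.kp_pos.le
  -- Subtracting the error part that `uBar` compensates leaves the barrier rate along `vs`.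
  have h4 : inner ℝ (S.err i p v) (S.gPsi i p) =
      inner ℝ (S.gPsi i p) (v i) - inner ℝ (S.gPsi i p) (S.vs i p) := by
    rw [real_inner_comm, err, inner_sub_right]
  rw [VDot, lyapDot]
  simp only [mulE_sub, mulE_add, inner_sub_right, inner_add_right,
    hS.inner_err_actuation] at h1 h2 ⊢
  rw [h4] at h1
  linarith

/-! ### The safety filter is the projection onto the feasible half-space -/

lemma uSafe_mem_feasible (i : Fin N) (p v : Fin N → Vec n) (t : ℝ) (w : Vec m) :
    S.uSafe i p v t w ∈ S.feasible i p v t := by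
  simp only [feasible, mem_ofPred_eq, uSafe]
  split_ifs with hw
  · have hφ : ‖S.phi i p v t‖ ≠ 0 := by
      rw [norm_ne_zero_iff]
      intro h
      simp [h] at hw
    rw [sub_right_comm, inner_sub_left, inner_smul_left, real_inner_self_eq_norm_sq,
      conj_trivial, div_mul_cancel₀ _ (pow_ne_zero 2 hφ), sub_self]
  · simpa using not_lt.1 hw

/-- The variational inequality characterising the projection onto the feasible half-space. -/
lemma inner_uSafe_sub_nonneg {i : Fin N} {p v : Fin N → Vec n} {t : ℝ} {w x : Vec m}
    (hx : x ∈ S.feasible i p v t) :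
    0 ≤ inner ℝ (S.uSafe i p v t w - w) (x - S.uSafe i p v t w) := by
  have hx' : inner ℝ (x - S.uBar i p v t) (S.phi i p v t) ≤ 0 := hx
  by_cases hw : 0 < inner ℝ (w - S.uBar i p v t) (S.phi i p v t)
  · have hφ : ‖S.phi i p v t‖ ≠ 0 := by
      rw [norm_ne_zero_iff]
      intro h
      simp [h] at hw
    rw [uSafe, if_pos hw]
    set c := inner ℝ (w - S.uBar i p v t) (S.phi i p v t) / ‖S.phi i p v t‖ ^ 2 with hc
    have hc0 : 0 ≤ c := by positivity
    have hcn : c * ‖S.phi i p v t‖ ^ 2 = inner ℝ (w - S.uBar i p v t) (S.phi i p v t) :=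
      div_mul_cancel₀ _ (pow_ne_zero 2 hφ)
    have e : inner ℝ (w - c • S.phi i p v t - w) (x - (w - c • S.phi i p v t)) =
        c * -inner ℝ (x - S.uBar i p v t) (S.phi i p v t) := by
      have : x - (w - c • S.phi i p v t) = (x - S.uBar i p v t) - (w - S.uBar i p v t) +
          c • S.phi i p v t := by abel
      rw [this, sub_sub_cancel_left, inner_neg_left, inner_smul_left, inner_add_right,
        inner_sub_right, inner_smul_right, real_inner_self_eq_norm_sq, hcn,
        real_inner_comm, real_inner_comm (w - S.uBar i p v t)]
      simp
    rw [e]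
    exact mul_nonneg hc0 (neg_nonneg.2 hx')
  · simp [uSafe, if_neg hw]

/-- The cross term of the expanded square is nonnegative by the variational inequality. The extra
square on the left yields uniqueness as well as minimality. -/
lemma norm_sub_sq_add_le {i : Fin N} {p v : Fin N → Vec n} {t : ℝ} {w x : Vec m}
    (hx : x ∈ S.feasible i p v t) :
    ‖S.uSafe i p v t w - w‖ ^ 2 + ‖x - S.uSafe i p v t w‖ ^ 2 ≤ ‖x - w‖ ^ 2 := by
  have h1 := inner_uSafe_sub_nonneg (w := w) hx
  have h2 : x - w = (S.uSafe i p v t w - w) + (x - S.uSafe i p v t w) := by abel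
  rw [h2, norm_add_sq_real]
  linarith

/-- The filtered input is the unique solution of the quadratic program. -/
lemma minimizers_eq_uSafe (i : Fin N) (p v : Fin N → Vec n) (t : ℝ) (w : Vec m) :
    {x | x ∈ S.feasible i p v t ∧
        IsMinOn (fun x => ‖x - w‖ ^ 2) (S.feasible i p v t) x} = {S.uSafe i p v t w} := by
  ext x
  simp only [mem_ofPred_eq, mem_singleton_iff]
  constructor
  · rintro ⟨hx, hmin⟩
    have h1 : ‖x - w‖ ^ 2 ≤ ‖S.uSafe i p v t w - w‖ ^ 2 :=
      isMinOn_iff.1 hmin _ (uSafe_mem_feasible i p v t w)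
    have h2 := norm_sub_sq_add_le (w := w) hx
    have h3 : ‖x - S.uSafe i p v t w‖ ^ 2 = 0 := le_antisymm (by linarith) (sq_nonneg _)
    exact sub_eq_zero.1 (norm_eq_zero.1 (pow_eq_zero_iff two_ne_zero |>.1 h3))
  · rintro rfl
    refine ⟨uSafe_mem_feasible i p v t w, isMinOn_iff.2 fun y hy => ?_⟩
    have := norm_sub_sq_add_le (w := w) hy
    linarith [sq_nonneg ‖y - S.uSafe i p v t w‖]

end MultiAgent

/-! ### A Grönwall bound, and continuity of matrix inverses and products. -/

/-- A function with `f' ≤ A + C f` on a bounded half-open interval is bounded above there. -/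
lemma exists_upperBound_of_deriv_le {f f' : ℝ → ℝ} {A C s τ : ℝ} (hC : 0 < C)
    (hf : ∀ t ∈ Ico s τ, HasDerivAt f (f' t) t) (hb : ∀ t ∈ Ico s τ, f' t ≤ A + C * f t) :
    ∃ b, ∀ t ∈ Ico s τ, f t ≤ b := by
  set g : ℝ → ℝ := fun t => (f t + A / C) * Real.exp (-C * t) with hg
  have hgd : ∀ t ∈ Ico s τ, HasDerivAt g
      (f' t * Real.exp (-C * t) + (f t + A / C) * (Real.exp (-C * t) * (-C * 1))) t :=
    fun t ht => ((hf t ht).add_const _).mul (((hasDerivAt_id t).const_mul (-C)).exp)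
  have hanti : AntitoneOn g (Ico s τ) := by
    refine antitoneOn_of_deriv_nonpos (convex_Ico s τ)
      (fun t ht => (hgd t ht).continuousAt.continuousWithinAt)
      (fun t ht => (hgd t (interior_subset ht)).differentiableAt.differentiableWithinAt)
      fun t ht => ?_
    rw [(hgd t (interior_subset ht)).deriv]
    have h1 := hb t (interior_subset ht)
    have h2 : f' t * Real.exp (-C * t) + (f t + A / C) * (Real.exp (-C * t) * (-C * 1)) =
        (f' t - (A + C * f t)) * Real.exp (-C * t) := by
      field_simp
      ring
    rw [h2]
    exact mul_nonpos_of_nonpos_of_nonneg (by linarith) (Real.exp_pos _).le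
  -- The absolute value allows `exp (C * t)` to be enlarged to `exp (C * τ)` whatever the sign of `g
  -- s`.
  refine ⟨|g s| * Real.exp (C * τ) - A / C, fun t ht => ?_⟩
  have h1 : g t ≤ |g s| :=
    (hanti (left_mem_Ico.2 (ht.1.trans_lt ht.2)) ht ht.1).trans (le_abs_self _)
  have h2 : f t + A / C = g t * Real.exp (C * t) := by
    rw [hg, mul_assoc, ← Real.exp_add]
    simp
  have h3 : g t * Real.exp (C * t) ≤ |g s| * Real.exp (C * τ) :=
    mul_le_mul h1 (Real.exp_le_exp.2 (mul_le_mul_of_nonneg_left ht.2.le hC.le))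
      (Real.exp_pos _).le (abs_nonneg _)
  linarith

lemma ContinuousOn.matrix_inv_of_posDef {X : Type*} [TopologicalSpace X] {k : ℕ} {K : Set X}
    {A : X → Matrix (Fin k) (Fin k) ℝ} (hA : ContinuousOn A K) (h : ∀ t ∈ K, (A t).PosDef) :
    ContinuousOn (fun t => (A t)⁻¹) K := by
  simp only [Matrix.inv_def, Ring.inverse_eq_inv']
  exact ((Continuous.matrix_det continuous_id).comp_continuousOn hA |>.inv₀
    fun t ht => (h t ht).det_pos.ne').smul
    ((Continuous.matrix_adjugate continuous_id).comp_continuousOn hA)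

lemma ContinuousOn.matrix_mul' {X : Type*} [TopologicalSpace X] {k l r : ℕ} {K : Set X}
    {A : X → Matrix (Fin k) (Fin l) ℝ} {B : X → Matrix (Fin l) (Fin r) ℝ}
    (hA : ContinuousOn A K) (hB : ContinuousOn B K) : ContinuousOn (fun t => A t * B t) K := by
  rw [continuousOn_iff_continuous_domRestrict] at *
  exact Continuous.matrix_mul hA hB

/-! ### The total barrier and its rate. -/

namespace MultiAgent

variable {N n m L : ℕ} {S : MultiAgent N n m L}

/-- Each pair of agents enters the total barrier twice, an obstacle once. -/
noncomputable def pairWeight : Fin N ⊕ Fin L → ℝ := Sum.elim (fun _ => 1 / 2) fun _ => 1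

/-- Velocity of an object; obstacles are at rest. -/
def objVel (v : Fin N → Vec n) : Fin N ⊕ Fin L → Vec n := Sum.elim v fun _ => 0

variable (S) in
/-- The barriers of all interacting pairs, for the neighbour sets `K`. -/
noncomputable def totalBarrier (K : Fin N → Finset (Fin N ⊕ Fin L)) (p : Fin N → Vec n) : ℝ :=
  ∑ i, ∑ o ∈ K i, pairWeight o * S.barrier (S.objPos p o - p i)

lemma pairWeight_pos (o : Fin N ⊕ Fin L) : 0 < pairWeight o := by
  cases o <;> simp [pairWeight]

lemma hasDerivAt_objPos {p : ℝ → Fin N → Vec n} {v : Fin N → Vec n} {t : ℝ}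
    (hp : ∀ i, HasDerivAt (fun s => p s i) (v i) t) (o : Fin N ⊕ Fin L) :
    HasDerivAt (fun s => S.objPos (p s) o) (objVel v o) t := by
  cases o with
  | inl j => exact hp j
  | inr k => exact hasDerivAt_const t (S.obs k)

lemma inl_mem_nbrs_comm {p : Fin N → Vec n} {i j : Fin N} :
    Sum.inl j ∈ S.nbrs p i ↔ Sum.inl i ∈ S.nbrs p j := by
  simp only [mem_nbrs, objPos, ne_eq, Sum.inl.injEq, norm_sub_rev (p j), eq_comm (a := j)]

lemma sum_nbrs_eq (p : Fin N → Vec n) (i : Fin N) (F : Fin N ⊕ Fin L → ℝ) :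
    ∑ o ∈ S.nbrs p i, F o = ∑ j, (if Sum.inl j ∈ S.nbrs p i then F (Sum.inl j) else 0) +
      ∑ k, (if Sum.inr k ∈ S.nbrs p i then F (Sum.inr k) else 0) := by
  rw [← Fintype.sum_sum_type (fun o => if o ∈ S.nbrs p i then F o else 0),
    Finset.sum_ite_mem, Finset.univ_inter]

/-- The rate of the total barrier is the sum of the contributions of the agents. -/
lemma Standing.sum_inner_gPsi (hS : S.Standing) {p : Fin N → Vec n} (hp : S.Safe p)
    (v : Fin N → Vec n) :
    ∑ i, inner ℝ (S.gPsi i p) (v i) = ∑ i, ∑ o ∈ S.nbrs p i,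
      pairWeight o * fderiv ℝ S.barrier (S.objPos p o - p i) (objVel v o - v i) := by
  have h1 : ∀ i, inner ℝ (S.gPsi i p) (v i) =
      -∑ o ∈ S.nbrs p i, fderiv ℝ S.barrier (S.objPos p o - p i) (v i) := fun i =>
    hS.inner_gradPsi (hp.h_pos_of_mem_nbrs i) (v i)
  -- Exchanging the two agents of a pair: the neighbour relation is symmetric and the barrier
  -- derivative is odd.
  have h2 : ∑ i, ∑ j, (if Sum.inl j ∈ S.nbrs p i then
        fderiv ℝ S.barrier (p j - p i) (v j) else 0) =
      -∑ i, ∑ j, (if Sum.inl j ∈ S.nbrs p i then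
        fderiv ℝ S.barrier (p j - p i) (v i) else 0) := by
    rw [Finset.sum_comm]
    simp only [← Finset.sum_neg_distrib]
    refine Finset.sum_congr rfl fun i _ => Finset.sum_congr rfl fun j _ => ?_
    simp only [inl_mem_nbrs_comm (i := j), fderiv_barrier_sub_comm (p i)]
    split_ifs <;> simp
  have h3 : ∀ i j, (if Sum.inl j ∈ S.nbrs p i then
        (1 / 2 : ℝ) * fderiv ℝ S.barrier (p j - p i) (v j - v i) else 0) =
      1 / 2 * (if Sum.inl j ∈ S.nbrs p i then fderiv ℝ S.barrier (p j - p i) (v j) else 0) -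
      1 / 2 * (if Sum.inl j ∈ S.nbrs p i then fderiv ℝ S.barrier (p j - p i) (v i) else 0) := by
    intro i j
    split_ifs
    · rw [map_sub, mul_sub]
    · simp
  have h4 : ∀ i k, (if Sum.inr k ∈ S.nbrs p i then
        (1 : ℝ) * fderiv ℝ S.barrier (S.obs k - p i) (0 - v i) else 0) =
      -(if Sum.inr k ∈ S.nbrs p i then fderiv ℝ S.barrier (S.obs k - p i) (v i) else 0) := by
    intro i k
    split_ifs <;> simp
  simp only [h1, sum_nbrs_eq, pairWeight, objVel, objPos, Sum.elim_inl, Sum.elim_inr, h3, h4,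
    Finset.sum_neg_distrib, Finset.sum_add_distrib, Finset.sum_sub_distrib, ← Finset.mul_sum, h2]
  ring

/-! ### The Lyapunov function along a solution. -/

section Along

variable {T : ℝ} {Z : Finset ℝ} {p v : ℝ → Fin N → Vec n} {u : ℝ → Fin N → Vec m}

lemma IsSolution.hasDerivAt_totalBarrier (hS : S.Standing) (h : S.IsSolution T Z p v u)
    {t : ℝ} (ht : t ∈ Ioo 0 T) (hZ : t ∉ Z) (hp : S.Safe (p t)) :
    HasDerivAt (fun s => S.totalBarrier (S.nbrs (p s)) (p s))
      (∑ i, inner ℝ (S.gPsi i (p t)) (v t i)) t := by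
  rw [hS.sum_inner_gPsi hp]
  have hev : (fun s => S.totalBarrier (S.nbrs (p s)) (p s)) =ᶠ[𝓝 t]
      fun s => S.totalBarrier (S.nbrs (p t)) (p s) := by
    filter_upwards [eventually_all.2 (h.nbrs_const t ht hZ)] with s hs
    rw [funext hs]
  refine HasDerivAt.congr_of_eventuallyEq ?_ hev
  exact HasDerivAt.fun_sum fun i _ => HasDerivAt.fun_sum fun o ho =>
    ((hS.differentiableAt_barrier (hp.h_pos_of_mem_nbrs i o ho)).hasFDerivAt.comp_hasDerivAt t
      ((hasDerivAt_objPos (h.p_deriv t ht hZ) o).sub (h.p_deriv t ht hZ i))).const_mul _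

lemma IsSolution.hasDerivAt_err (h : S.IsSolution T Z p v u) {t : ℝ} (ht : t ∈ Ioo 0 T)
    (hZ : t ∉ Z) (i : Fin N) :
    HasDerivAt (fun s => S.err i (p s) (v s))
      (S.f i (p t i) (v t i) t + mulE (S.B i (p t i) (v t i) t) (u t i) -
        S.vsDot i (p t) (v t)) t := by
  have hpd : HasDerivAt p (v t) t := hasDerivAt_pi.2 (h.p_deriv t ht hZ)
  have h1 : HasDerivAt (fun s => S.safeVel (S.nbrs (p t) i) i (p s))
      (S.vsDot i (p t) (v t)) t :=
    (h.vs_diff t ht hZ i).hasFDerivAt.comp_hasDerivAt t hpd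
  refine ((h.v_deriv t ht hZ i).sub h1).congr_of_eventuallyEq ?_
  filter_upwards [h.nbrs_const t ht hZ i] with s hs
  simp only [err, vs, hs, Pi.sub_apply]

lemma IsSolution.hasDerivAt_lyap (hS : S.Standing) (h : S.IsSolution T Z p v u)
    {t : ℝ} (ht : t ∈ Ioo 0 T) (hZ : t ∉ Z) (i : Fin N) :
    HasDerivAt (fun s => S.lyap i (p s) (v s) s)
      (S.lyapDot i (p t) (v t) t (u t i)) t := by
  have hM : ∀ a b, HasDerivAt (fun s => S.M i (p s i) s a b) (S.MDot i (p t) (v t) t a b) t :=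
    fun a b => HasFDerivAt.comp_hasDerivAt (f := fun s => (p s i, s)) t
      (hS.M_diff i a b (p t i, t)).hasFDerivAt ((h.p_deriv t ht hZ i).prodMk (hasDerivAt_id t))
  have h1 := (hasDerivAt_quadForm (A := fun s => S.M i (p s i) s) hM (h.hasDerivAt_err ht hZ i)
    (hS.M_posDef i (p t i) t).transpose_eq).div_const 2
  refine h1.congr_deriv ?_
  rw [lyapDot]
  ring

variable (S) in
/-- The total Lyapunov function. -/
noncomputable def totalLyap (p v : Fin N → Vec n) (t : ℝ) : ℝ :=
  S.kp * S.totalBarrier (S.nbrs p) p + ∑ i, S.lyap i p v t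

lemma IsSolution.hasDerivAt_totalLyap (hS : S.Standing) (h : S.IsSolution T Z p v u)
    {t : ℝ} (ht : t ∈ Ioo 0 T) (hZ : t ∉ Z) (hp : S.Safe (p t)) :
    HasDerivAt (fun s => S.totalLyap (p s) (v s) s)
      (∑ i, S.VDot i (p t) (v t) t (u t i)) t := by
  have h1 := ((h.hasDerivAt_totalBarrier hS ht hZ hp).const_mul S.kp).add
    (HasDerivAt.fun_sum fun i (_ : i ∈ Finset.univ) => h.hasDerivAt_lyap hS ht hZ i)
  refine h1.congr_deriv ?_
  simp only [VDot, Finset.sum_add_distrib, Finset.mul_sum]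

lemma IsSolution.continuousOn_M (hS : S.Standing) (h : S.IsSolution T Z p v u) (i : Fin N) :
    ContinuousOn (fun t => S.M i (p t i) t) (Icc 0 T) :=
  continuousOn_pi.2 fun a => continuousOn_pi.2 fun b =>
    (hS.M_diff i a b).continuous.comp_continuousOn
      ((continuousOn_pi.1 h.p_cont i).prodMk continuousOn_id)

lemma IsSolution.continuousOn_gain (hS : S.Standing) (h : S.IsSolution T Z p v u) (i : Fin N) :
    ContinuousOn (fun t => S.gain i (p t) (v t) t) (Icc 0 T) := by
  have hM := h.continuousOn_M hS i
  have hB : ContinuousOn (fun t => S.B i (p t i) (v t i) t) (Icc 0 T) :=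
    (hS.B_cont i).comp_continuousOn ((continuousOn_pi.1 h.p_cont i).prodMk
      ((continuousOn_pi.1 h.v_cont i).prodMk continuousOn_id))
  have hBt : ContinuousOn (fun t => (S.B i (p t i) (v t i) t)ᵀ) (Icc 0 T) :=
    (Continuous.matrix_transpose continuous_id).comp_continuousOn hB
  have hR : ContinuousOn (fun t => S.R i (p t) (v t) t) (Icc 0 T) :=
    (hS.R_cont i).comp_continuousOn (h.p_cont.prodMk (h.v_cont.prodMk continuousOn_id))
  have hRi := hR.matrix_inv_of_posDef fun t _ => hS.R_posDef i (p t) (v t) t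
  exact (((hM.matrix_mul' hB).matrix_mul' hRi).matrix_mul' hBt).matrix_mul' hM

lemma IsSolution.exists_gain_le (hS : S.Standing) (h : S.IsSolution T Z p v u) :
    ∃ C > 0, ∀ i, ∀ t ∈ Icc 0 T,
      quadForm (S.gain i (p t) (v t) t) (S.err i (p t) (v t)) ≤ C * S.lyap i (p t) (v t) t := by
  -- The bound is uniform over all vectors because the error may jump when neighbour sets change;
  -- only the matrices are continuous in time.
  choose c hc using fun i => exists_quadForm_le_mul isCompact_Icc (h.continuousOn_gain hS i)
    (h.continuousOn_M hS i) fun t _ => hS.M_posDef i (p t i) t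
  -- The sum dominates every agent's constant, the factor 2 undoes the half in `lyap`, and the
  -- summand 1 ensures positivity.
  refine ⟨1 + ∑ i, 2 * |c i|, by positivity, fun i t ht => (hc i t ht _).trans ?_⟩
  have h1 : 2 * |c i| ≤ ∑ i, 2 * |c i| :=
    Finset.single_le_sum (f := fun i => 2 * |c i|) (fun _ _ => by positivity)
      (Finset.mem_univ i)
  have h2 : c i * quadForm (S.M i (p t i) t) (S.err i (p t) (v t)) =
      2 * c i * S.lyap i (p t) (v t) t := by
    rw [lyap]
    ring
  rw [h2]
  refine mul_le_mul_of_nonneg_right ?_ (hS.lyap_nonneg _ _ _ _)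
  linarith [le_abs_self (c i)]

lemma Standing.totalBarrier_nonneg (hS : S.Standing) {p : Fin N → Vec n} (hp : S.Safe p) :
    0 ≤ S.totalBarrier (S.nbrs p) p :=
  Finset.sum_nonneg fun i _ => Finset.sum_nonneg fun o ho =>
    mul_nonneg (pairWeight_pos o).le
      (hS.barrier_nonneg (hp.h_pos_of_mem_nbrs i o ho) (mem_nbrs.1 ho).2)

lemma Standing.le_totalBarrier (hS : S.Standing) {p : Fin N → Vec n} (hp : S.Safe p)
    {i : Fin N} {o : Fin N ⊕ Fin L} (ho : o ∈ S.nbrs p i) :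
    pairWeight o * S.barrier (S.objPos p o - p i) ≤ S.totalBarrier (S.nbrs p) p := by
  have h0 : ∀ i, ∀ o ∈ S.nbrs p i, 0 ≤ pairWeight o * S.barrier (S.objPos p o - p i) :=
    fun i o ho => mul_nonneg (pairWeight_pos o).le
      (hS.barrier_nonneg (hp.h_pos_of_mem_nbrs i o ho) (mem_nbrs.1 ho).2)
  exact (Finset.single_le_sum (f := fun o => pairWeight o * S.barrier (S.objPos p o - p i))
    (h0 i) ho).trans (Finset.single_le_sum
      (f := fun i => ∑ o ∈ S.nbrs p i, pairWeight o * S.barrier (S.objPos p o - p i))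
      (fun i _ => Finset.sum_nonneg (h0 i)) (Finset.mem_univ i))

/-! ### Excluding a first collision. -/

lemma isOpen_safe : IsOpen {p : Fin N → Vec n | S.Safe p} := by
  have hc : ∀ o, Continuous fun p : Fin N → Vec n => S.objPos p o := by
    rintro (j | k)
    · exact continuous_apply j
    · exact continuous_const
  simp only [Safe, ofPred_forall]
  exact isOpen_iInter_of_finite fun i => isOpen_iInter_of_finite fun o =>
    isOpen_iInter_of_finite fun _ =>
      isOpen_lt continuous_const (continuous_h.comp ((hc o).sub (continuous_apply i)))

/-- A bound of the total barrier before a time `τ` excludes a collision at `τ`. -/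
lemma Standing.safe_of_totalBarrier_le (hS : S.Standing) {s τ b : ℝ} (hsτ : s < τ)
    (hp : ContinuousWithinAt p (Iio τ) τ) (hsafe : ∀ t ∈ Ico s τ, S.Safe (p t))
    (hb : ∀ t ∈ Ico s τ, S.totalBarrier (S.nbrs (p t)) (p t) ≤ b) : S.Safe (p τ) := by
  intro i o ho
  by_contra! hneg
  have hrel : Tendsto (fun t => S.objPos (p t) o - p t i) (𝓝[<] τ)
      (𝓝 (S.objPos (p τ) o - p τ i)) := by
    have hi : ∀ j, Tendsto (fun t => p t j) (𝓝[<] τ) (𝓝 (p τ j)) := tendsto_pi_nhds.1 hp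
    refine Tendsto.sub ?_ (hi i)
    cases o with
    | inl j => exact hi j
    | inr k => exact tendsto_const_nhds
  have hsens : ‖S.objPos (p τ) o - p τ i‖ < S.rsen :=
    hS.sensed _ (not_lt.1 fun hlt => hneg.not_gt ((hS.h_pos_iff _).2 hlt))
  have hev : ∀ᶠ t in 𝓝[<] τ,
      Real.exp (-(b / pairWeight o)) ≤ S.h (S.objPos (p t) o - p t i) := by
    filter_upwards [hrel.norm.eventually (gt_mem_nhds hsens), Ico_mem_nhdsLT hsτ] with t h1 ht
    have h2 := (hS.le_totalBarrier (hsafe t ht) (mem_nbrs.2 ⟨ho, h1.le⟩)).trans (hb t ht)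
    have h3 := (le_div_iff₀' (pairWeight_pos o)).2 h2
    rw [← Real.le_log_iff_exp_le (hsafe t ht i o ho)]
    rw [barrier] at h3
    linarith
  have h4 : Tendsto (fun t => S.h (S.objPos (p t) o - p t i)) (𝓝[<] τ)
      (𝓝 (S.h (S.objPos (p τ) o - p τ i))) := (continuous_h.tendsto _).comp hrel
  exact absurd ((ge_of_tendsto h4 hev).trans hneg) (Real.exp_pos _).not_ge

/-- Feasible inputs keep the system collision-free. -/
theorem IsSolution.safe (hS : S.Standing) (ha : 1 ≤ S.a) (h : S.IsSolution T Z p v u)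
    (hC : ∀ t ∈ Ioo 0 T, t ∉ Z → ∀ i, S.Contraction i (p t) (v t) t)
    (hN : ∀ t ∈ Ioo 0 T, t ∉ Z → ∀ i, S.Natural i (p t) (v t) t)
    (hu : ∀ t ∈ Ioo 0 T, t ∉ Z → ∀ i, u t i ∈ S.feasible i (p t) (v t) t)
    (h0 : S.Safe (p 0)) : ∀ t ∈ Icc 0 T, S.Safe (p t) := by
  by_contra! hne
  set U : Set ℝ := Icc 0 T ∩ p ⁻¹' {q | S.Safe q}ᶜ
  have hUc : IsCompact U := isCompact_Icc.of_isClosed_subset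
    (h.p_cont.preimage_isClosed_of_isClosed isClosed_Icc isOpen_safe.isClosed_compl)
    inter_subset_left
  obtain ⟨t₀, ht₀, hbad⟩ := hne
  obtain ⟨τ, hτ⟩ := hUc.exists_isLeast ⟨t₀, ht₀, hbad⟩
  have hτT : τ ≤ T := hτ.1.1.2
  have hτ0 : 0 < τ := by
    refine lt_of_le_of_ne hτ.1.1.1 ?_
    rintro rfl
    exact hτ.1.2 h0
  have hbefore : ∀ t, 0 ≤ t → t < τ → S.Safe (p t) := fun t h1 h2 => by
    by_contra hns
    exact h2.not_ge (hτ.2 ⟨⟨h1, h2.le.trans hτT⟩, hns⟩)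
  -- The time `τ` may itself be exceptional, so it is erased from `Z`; the remaining finite set
  -- stays away from a neighbourhood of `τ`.
  have hZev : ∀ᶠ t in 𝓝[<] τ, t ∉ Z ∧ 0 < t := by
    refine Filter.Eventually.and ?_ (eventually_nhdsWithin_of_eventually_nhds (lt_mem_nhds hτ0))
    have h1 : ∀ᶠ t in 𝓝 τ, t ∉ Z.erase τ :=
      (Z.erase τ).finite_toSet.isClosed.isOpen_compl.mem_nhds (by simp)
    filter_upwards [eventually_nhdsWithin_of_eventually_nhds h1, self_mem_nhdsWithin] with t h2 h3
    exact fun h4 => h2 (Finset.mem_erase.2 ⟨ne_of_lt h3, h4⟩)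
  obtain ⟨l, hl, hlZ⟩ := mem_nhdsLT_iff_exists_Ioo_subset.1 hZev
  obtain ⟨s, hls, hsτ⟩ := exists_between (mem_Iio.1 hl)
  have hreg : ∀ t ∈ Ico s τ, t ∈ Ioo 0 T ∧ t ∉ Z ∧ S.Safe (p t) := fun t ht => by
    obtain ⟨h1, h2⟩ := hlZ ⟨hls.trans_le ht.1, ht.2⟩
    exact ⟨⟨h2, ht.2.trans_le hτT⟩, h1, hbefore t h2.le ht.2⟩
  obtain ⟨C, hCpos, hgain⟩ := h.exists_gain_le hS
  obtain ⟨b, hb⟩ := exists_upperBound_of_deriv_le (A := N * (S.kp * S.α 1)) hCpos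
    (fun t ht => h.hasDerivAt_totalLyap hS (hreg t ht).1 (hreg t ht).2.1 (hreg t ht).2.2)
    fun t ht => by
      obtain ⟨h1, h2, h3⟩ := hreg t ht
      have h4 : ∀ i, S.VDot i (p t) (v t) t (u t i) ≤
          S.kp * S.α 1 + C * S.lyap i (p t) (v t) t := fun i =>
        (hS.VDot_le ha h3 (hC t h1 h2 i) (hN t h1 h2 i) (hu t h1 h2 i)).trans
          (add_le_add_right (hgain i t (Ioo_subset_Icc_self h1)) _)
      refine (Finset.sum_le_sum fun i _ => h4 i).trans ?_
      rw [Finset.sum_add_distrib, ← Finset.mul_sum Finset.univ _ C, totalLyap, mul_add C]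
      -- Adding the nonnegative barrier part turns the bound by the tracking energies into one by
      -- `totalLyap`, closing the Grönwall inequality.
      have h5 := mul_nonneg hCpos.le (mul_nonneg hS.kp_pos.le (hS.totalBarrier_nonneg h3))
      simp only [Finset.sum_const, Finset.card_univ, Fintype.card_fin, nsmul_eq_mul]
      linarith
  refine hτ.1.2 (hS.safe_of_totalBarrier_le (b := b / S.kp) hsτ ?_
    (fun t ht => (hreg t ht).2.2) fun t ht => ?_)
  · exact (h.p_cont τ hτ.1.1).mono_of_mem_nhdsWithin
      (mem_of_superset (Ioo_mem_nhdsLT hτ0) fun t ht => ⟨ht.1.le, ht.2.le.trans hτT⟩)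
  · rw [le_div_iff₀' hS.kp_pos]
    have h1 : S.totalLyap (p t) (v t) t ≤ b := hb t ht
    have h2 : 0 ≤ ∑ i, S.lyap i (p t) (v t) t :=
      Finset.sum_nonneg fun i _ => hS.lyap_nonneg i (p t) (v t) t
    rw [totalLyap] at h1
    linarith

end Along

end MultiAgent

theorem mainTheorem2 {N n m L : ℕ} (S : MultiAgent N n m L) (hS : S.Standing)
    (hα : S.AlphaBound)
    (uL : Fin N → (Fin N → Vec n) → (Fin N → Vec n) → ℝ → Vec m) :
    (∀ (T : ℝ) (Z : Finset ℝ) (p v : ℝ → Fin N → Vec n) (u : ℝ → Fin N → Vec m),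
      S.IsSolution T Z p v u →
      (∀ t ∈ Set.Ioo 0 T, t ∉ Z → ∀ i, S.Contraction i (p t) (v t) t) →
      (∀ t ∈ Set.Ioo 0 T, t ∉ Z → ∀ i, S.Natural i (p t) (v t) t) →
      (∀ t ∈ Set.Ioo 0 T, t ∉ Z → ∀ i, u t i ∈ S.feasible i (p t) (v t) t) →
      S.Safe (p 0) → ∀ t ∈ Set.Icc 0 T, S.Safe (p t)) ∧
    (∀ (T : ℝ) (Z : Finset ℝ) (p v : ℝ → Fin N → Vec n),
      S.IsSolution T Z p v
        (fun t i => S.uSafe i (p t) (v t) t (uL i (p t) (v t) t)) →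
      (∀ t ∈ Set.Ioo 0 T, t ∉ Z → ∀ i, S.Contraction i (p t) (v t) t) →
      (∀ t ∈ Set.Ioo 0 T, t ∉ Z → ∀ i, S.Natural i (p t) (v t) t) →
      S.Safe (p 0) → ∀ t ∈ Set.Icc 0 T, S.Safe (p t)) ∧
    (∀ (i : Fin N) (p v : Fin N → Vec n) (t : ℝ),
      (S.feasible i p v t).Nonempty ∧
      {w | w ∈ S.feasible i p v t ∧
          IsMinOn (fun w => ‖w - uL i p v t‖ ^ 2) (S.feasible i p v t) w}
        = {S.uSafe i p v t (uL i p v t)}) :=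
  ⟨fun _ _ _ _ _ h hC hN hu h0 => h.safe hS hα.1 hC hN hu h0,
    fun _ _ _ _ h hC hN h0 => h.safe hS hα.1 hC hN
      (fun _ _ _ i => MultiAgent.uSafe_mem_feasible i _ _ _ _) h0,
    fun i p v t => ⟨⟨_, MultiAgent.uSafe_mem_feasible i p v t (uL i p v t)⟩,
      MultiAgent.minimizers_eq_uSafe i p v t (uL i p v t)⟩⟩
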